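/- Let $k\ge 3$ be an integer and let $T_k:[0,1)\to[0,1)$, $T_k(x)=kx \bmod 1$. For $0\le a<b\le 1$ let $d_k(a,b)$ be the Hausdorff dimension of the survivor set $\{x\in[0,1) : T_k^n(x)\notin(a,b)\text{ for all } n\ge 0\}$, and let $$R_2=\{(a,b) : 0\le a\le \tfrac1k,\ \tfrac{k-1}{k}\le b\le 1\}.$$ Let $g_k:[0,1]\to[0,1]$ be the generalized Cantor function: if $x=\sum_{n\ge1}a_nk^{-n}$ with $a_n\in\{0,\dots,k-1\}$, then $g_k(x)=\sum_{n\ge 1}\frac{a_n}{(k-1)2^n}$ if all $a_n\in\{0,k-1\}$, and otherwise $g_k(x)=\sum_{n=1}^{N-1}\frac{a_n}{(k-1)2^n}+\frac1{2^N}$, where $N$ is the least index with $a_N\notin\{0,k-1\}$ (the value does not depend on the choice of the expansion of $x$). Let $a_*=\sum_{n\ge0}t_n2^{-(n+1)}\approx 0.41245$ be the Thue–Morse constant, where $t_n\in\{0,1\}$ is the parity of the number of ones in the binary expansion of $n$. Then there is exactly one point $c\in[0,1]$ with $g_k(c)=a_*$; write $c=g_k^{-1}(a_*)$. For all $(a,b)\in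 R_2$, $$b-a<1-2\,g_k^{-1}(a_*)\quad\Longrightarrow\quad d_k(a,b)>0 .$$ This bound is sharp: there is a hole $(a,b)\in R_2$ with $b-a=1-2\,g_k^{-1}(a_*)$ and $d_k(a,b)=0$. -/

import Mathlib

/-- The map `T_k(x) = k x mod 1` (a self-map of `[0,1)`). -/
noncomputable def expandingMap (k : ℕ) (x : ℝ) : ℝ := Int.fract ((k : ℝ) * x)

/-- The survivor set `W_k(a,b)`: the points of `[0,1)` whose forward orbit under `T_k` never
enters the hole `(a,b)`. -/
def survivorSet (k : ℕ) (a b : ℝ) : Set ℝ :=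
  {x | x ∈ Set.Ico (0 : ℝ) 1 ∧ ∀ n : ℕ, (expandingMap k)^[n] x ∉ Set.Ioo a b}

/-- `d_k(a,b)`: the Hausdorff dimension of the survivor set. -/
noncomputable def survivorDim (k : ℕ) (a b : ℝ) : ENNReal := dimH (survivorSet k a b)

/-- The holes `(a,b)` with `0 ≤ a ≤ 1/k` and `(k-1)/k ≤ b ≤ 1`. -/
def holesR2 (k : ℕ) : Set (ℝ × ℝ) :=
  {p | (0 ≤ p.1 ∧ p.1 ≤ 1 / (k : ℝ)) ∧ (((k : ℝ) - 1) / (k : ℝ) ≤ p.2 ∧ p.2 ≤ 1)}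

/-- The digits of the `k`-expansion of `x ∈ [0,1)` that does not end in `(k-1)^∞`, indexed from
zero: `x = ∑ n, kDigit k x n / k ^ (n + 1)`. -/
noncomputable def kDigit (k : ℕ) (x : ℝ) (n : ℕ) : ℕ := ⌊(k : ℝ) ^ (n + 1) * x⌋₊ % k

/-- A `k`-expansion of `x ∈ [0,1]`: the one above for `x < 1`, and `(k-1)^∞` for `x = 1`. -/
noncomputable def kExpansion (k : ℕ) (x : ℝ) (n : ℕ) : ℕ :=
  if x < 1 then kDigit k x n else k - 1

open Classical in
/-- The generalized Cantor function `g_k` on `[0,1]`. If some digit of the `k`-expansion of `x`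
is neither `0` nor `k - 1`, and `N` is the (zero-based) position of the first such digit, then
`g_k(x) = ∑_{n < N} a_n / ((k-1) 2^(n+1)) + 1 / 2^(N+1)`; otherwise
`g_k(x) = ∑_n a_n / ((k-1) 2^(n+1))`. -/
noncomputable def cantorFun (k : ℕ) (x : ℝ) : ℝ :=
  if h : ∃ n, kExpansion k x n ≠ 0 ∧ kExpansion k x n ≠ k - 1 then
    (∑ n ∈ Finset.range (Nat.find h), (kExpansion k x n : ℝ) / (((k : ℝ) - 1) * 2 ^ (n + 1)))
      + 1 / 2 ^ (Nat.find h + 1)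
  else
    ∑' n : ℕ, (kExpansion k x n : ℝ) / (((k : ℝ) - 1) * 2 ^ (n + 1))

/-- The Thue–Morse sequence `0 1 10 1001 ⋯`, indexed from zero: the parity of the number of ones
in the binary expansion of `n`. -/
def thueMorse (n : ℕ) : ℕ := (Nat.digits 2 n).sum % 2

/-- The Thue–Morse constant `a_* = 0.0110 1001 ⋯` in base two, about `0.41245`. -/
noncomputable def thueMorseConst : ℝ := ∑' n : ℕ, (thueMorse n : ℝ) / 2 ^ (n + 1)

/-!
Points whose orbits avoid a hole in `R_2` have (up to exceptional points) only the digits `0` and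
`k - 1`, so they are values `val k w` of binary sequences `w`, and the map becomes the shift. A
sequence avoids the hole when its tails beginning with `0` stay below one bound and its tails
beginning with `1` stay above another (`Adm`). The substitution `rho`, `0 ↦ 01`, `1 ↦ 10`, preserves
this order condition, and it fixes the Thue–Morse sequence `tm`. The point `c` is `val k tm`: it is
the only solution of `g_k(c) = a_*` because `g_k(x)` is the binary value of a sequence, and a binary
value determines a sequence that is not eventually constant.

*Dimension zero at `(c, 1 - c)`.* Every sequence admissible for the bounds `tm` and `compl tm` is
constant or has a tail that is `rho` of another such sequence (`adm_tm_cases`). Since `rho` doubles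
the length of common prefixes, it is Hölder of exponent two on values, so the dimension `d` of the
survivor set satisfies `d ≤ d / 2` (`dimH_adm_tm`).

*Positive dimension for shorter holes.* Suppose that the dimension is zero and `b - a < 1 - 2c`. By
induction on `n`, `a` lies between the values of `rho^n (0^∞)` and `rho^n (01^∞)`, and `b` between
those of `rho^n (10^∞)` and `rho^n (1^∞)` (`bounds_of_survivorDim_eq_zero`). For `n = 0` this is the
definition of `R_2`. For the step, if `b` exceeded `rho^n ((10)^∞)`, then even with the largest
possible `a` the hole would have length at least `1 - 2c` (`gap_le`, where `k ≥ 3` enters). If then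
`a` exceeded `rho^n (01(10)^∞)`, a freely parametrized family of sequences would avoid the hole
(`exists_free_family`), and such a family has positive dimension because it maps onto `[0,1]` by a
Hölder map (`dimH_range_val_pos`). The two remaining bounds follow by the reflection `x ↦ 1 - x`.
As `n → ∞` the bounds force `a = c` and `b = 1 - c`, a contradiction.
-/

namespace ThueMorseHole

open scoped NNReal ENNReal

/-! ### Binary sequences -/

/-- The sequence `w` with its first `m` terms removed. -/
def shift (m : ℕ) (w : ℕ → Bool) : ℕ → Bool := fun i => w (m + i)

/-- The sequence with every term flipped. -/
def compl (w : ℕ → Bool) : ℕ → Bool := fun i => !w i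

/-- The Thue–Morse substitution `0 ↦ 01`, `1 ↦ 10`. -/
def rho (w : ℕ → Bool) : ℕ → Bool := fun i => xor (w (i / 2)) (decide (i % 2 = 1))

/-- The Thue–Morse sequence as a sequence of Booleans. -/
def tm : ℕ → Bool := fun n => decide (thueMorse n = 1)

/-- The sequence `0 1 1 1 ⋯`. -/
def zeroOnes : ℕ → Bool := fun i => decide (i ≠ 0)

/-- The sequence `1 1 1 ⋯`. -/
def ones : ℕ → Bool := fun _ => true

/-- The lexicographic order `w ≤ z`: at every position preceded by agreement only, the term of `w`
is at most that of `z`. -/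
def LexLe (w z : ℕ → Bool) : Prop := ∀ n, (∀ i < n, w i = z i) → w n = true → z n = true

/-- Every tail of `w` is at most `α` if it begins with `0`, and at least `β` if it begins
with `1`. -/
def Adm (w α β : ℕ → Bool) : Prop :=
  ∀ m, (w m = false → LexLe (shift m w) α) ∧ (w m = true → LexLe β (shift m w))

@[simp] lemma compl_compl (w : ℕ → Bool) : compl (compl w) = w := by
  funext i; simp [compl]

lemma shift_zero (w : ℕ → Bool) : shift 0 w = w := by
  funext i; simp [shift]

lemma shift_shift (m n : ℕ) (w : ℕ → Bool) : shift m (shift n w) = shift (n + m) w := by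
  funext i; simp [shift, Nat.add_assoc]

lemma shift_compl (m : ℕ) (w : ℕ → Bool) : shift m (compl w) = compl (shift m w) := rfl

@[simp] lemma rho_two_mul (w : ℕ → Bool) (i : ℕ) : rho w (2 * i) = w i := by
  simp [rho]

@[simp] lemma rho_two_mul_add_one (w : ℕ → Bool) (i : ℕ) : rho w (2 * i + 1) = !w i := by
  have h1 : (2 * i + 1) / 2 = i := by omega
  have h2 : (2 * i + 1) % 2 = 1 := by omega
  simp [rho, h1, h2]

lemma rho_compl (w : ℕ → Bool) : rho (compl w) = compl (rho w) := by
  funext i; simp [rho, compl]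

lemma iterate_rho_compl (n : ℕ) (w : ℕ → Bool) : rho^[n] (compl w) = compl (rho^[n] w) := by
  induction n generalizing w with
  | zero => rfl
  | succ n ih => rw [Function.iterate_succ_apply, Function.iterate_succ_apply, rho_compl, ih]

lemma shift_two_mul_rho (m : ℕ) (w : ℕ → Bool) : shift (2 * m) (rho w) = rho (shift m w) := by
  funext i
  have h1 : (2 * m + i) / 2 = m + i / 2 := by omega
  have h2 : (2 * m + i) % 2 = i % 2 := by omega
  simp [rho, shift, h1, h2]

lemma eq_rho_of_alternating {w : ℕ → Bool} (h : ∀ t, w (2 * t + 1) = !w (2 * t)) :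
    w = rho fun t => w (2 * t) := by
  funext i
  obtain ⟨t, rfl | rfl⟩ := Nat.even_or_odd' i
  · simp
  · simp [h]

lemma rho_agree {w z : ℕ → Bool} {m : ℕ} (h : ∀ i < m, w i = z i) :
    ∀ i < 2 * m, rho w i = rho z i := by
  intro i hi
  simp only [rho, h (i / 2) (by omega)]

lemma iterate_rho_agree {w z : ℕ → Bool} {m : ℕ} (h : ∀ i < m, w i = z i) (n : ℕ) :
    ∀ i < m * 2 ^ n, rho^[n] w i = rho^[n] z i := by
  induction n generalizing w z m with
  | zero => simpa using h
  | succ n ih =>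
    intro i hi
    rw [Function.iterate_succ_apply, Function.iterate_succ_apply]
    exact ih (rho_agree h) i (by rw [pow_succ] at hi; linarith)

lemma iterate_rho_mul (w : ℕ → Bool) (n i : ℕ) : rho^[n] w (2 ^ n * i) = w i := by
  induction n generalizing w with
  | zero => simp
  | succ n ih =>
    rw [Function.iterate_succ_apply', pow_succ, mul_comm (2 ^ n) 2, mul_assoc, rho_two_mul, ih]

/-! ### The Thue–Morse sequence -/

lemma thueMorse_two_mul (n : ℕ) : thueMorse (2 * n) = thueMorse n := by
  rcases Nat.eq_zero_or_pos n with rfl | hn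
  · rfl
  · have h := Nat.digits_add_two_add_one 0 (2 * n - 1)
    have h1 : 2 * n - 1 + 1 = 2 * n := by omega
    rw [h1] at h
    simp [thueMorse, h]

lemma thueMorse_two_mul_add_one (n : ℕ) :
    thueMorse (2 * n + 1) = (thueMorse n + 1) % 2 := by
  have h := Nat.digits_add_two_add_one 0 (2 * n)
  have h1 : (2 * n + 1) / 2 = n := by omega
  have h2 : (2 * n + 1) % 2 = 1 := by omega
  simp only [zero_add] at h
  rw [h1, h2] at h
  simp only [thueMorse, h, List.sum_cons]
  omega

lemma thueMorse_lt_two (n : ℕ) : thueMorse n < 2 := Nat.mod_lt _ two_pos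

lemma tm_two_mul (n : ℕ) : tm (2 * n) = tm n := by simp [tm, thueMorse_two_mul]

lemma tm_two_mul_add_one (n : ℕ) : tm (2 * n + 1) = !tm n := by
  have := thueMorse_lt_two n
  simp only [tm, thueMorse_two_mul_add_one]
  interval_cases thueMorse n <;> simp

lemma rho_tm : rho tm = tm := by
  have h := eq_rho_of_alternating (w := tm) fun t => by rw [tm_two_mul_add_one, tm_two_mul]
  simp only [tm_two_mul] at h
  exact h.symm

lemma iterate_rho_tm (n : ℕ) : rho^[n] tm = tm := Function.iterate_fixed rho_tm n

lemma tm_zero : tm 0 = false := by simp [tm, thueMorse]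
lemma tm_one : tm 1 = true := by have := tm_two_mul_add_one 0; simpa [tm_zero] using this
lemma tm_two : tm 2 = true := by have := tm_two_mul 1; simpa [tm_one] using this
lemma tm_three : tm 3 = false := by have := tm_two_mul_add_one 1; simpa [tm_one] using this
lemma tm_four : tm 4 = true := by have := tm_two_mul 2; simpa [tm_two] using this
lemma tm_five : tm 5 = false := by have := tm_two_mul_add_one 2; simpa [tm_two] using this
lemma tm_six : tm 6 = false := by have := tm_two_mul 3; simpa [tm_three] using this

lemma exists_tm_eq (b : Bool) (n : ℕ) : ∃ m ≥ n, tm m = b := by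
  by_cases h : tm (2 * n) = b
  · exact ⟨2 * n, by omega, h⟩
  · refine ⟨2 * n + 1, by omega, ?_⟩
    rw [tm_two_mul_add_one, ← tm_two_mul]
    revert h; cases tm (2 * n) <;> cases b <;> simp

/-! ### The lexicographic order -/

lemma lexLe_of_lt {w z : ℕ → Bool} {n : ℕ} (h : ∀ i < n, w i = z i) (hw : w n = false)
    (hz : z n = true) : LexLe w z := by
  intro m hm hwm
  rcases lt_trichotomy m n with hlt | rfl | hgt
  · rw [← h m hlt, hwm]
  · exact hz
  · have := hm n hgt
    simp_all

lemma exists_first_diff {w z : ℕ → Bool} (h : w ≠ z) :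
    ∃ n, (∀ i < n, w i = z i) ∧ w n ≠ z n := by
  classical
  have hex : ∃ n, w n ≠ z n := Function.ne_iff.mp h
  exact ⟨Nat.find hex, fun i hi => not_not.mp (Nat.find_min hex hi), Nat.find_spec hex⟩

lemma lexLe_compl {w z : ℕ → Bool} (h : LexLe w z) : LexLe (compl z) (compl w) := by
  intro n hn hz
  have h1 := h n fun i hi => by have := hn i hi; simp [compl] at this; exact this.symm
  simp only [compl, Bool.not_eq_true'] at hz ⊢
  by_contra hw
  simp [h1 (by simpa using hw)] at hz

lemma lexLe_rho {w z : ℕ → Bool} (h : LexLe w z) : LexLe (rho w) (rho z) := by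
  by_cases hwz : w = z
  · subst hwz; exact fun _ _ h => h
  obtain ⟨n, hn, hne⟩ := exists_first_diff hwz
  have h1 := h n hn
  refine lexLe_of_lt (n := 2 * n) (rho_agree hn) ?_ ?_ <;> rw [rho_two_mul] <;>
    revert h1 hne <;> cases w n <;> cases z n <;> simp

lemma lexLe_of_rho {w z : ℕ → Bool} (h : LexLe (rho w) (rho z)) : LexLe w z := by
  intro n hn hw
  have := h (2 * n) (rho_agree hn)
  simp only [rho_two_mul] at this
  exact this hw

/-! ### Admissible sequences -/

lemma adm_compl {w α β : ℕ → Bool} (h : Adm w α β) : Adm (compl w) (compl β) (compl α) := by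
  intro m
  refine ⟨fun hm => ?_, fun hm => ?_⟩ <;> rw [shift_compl] <;> apply lexLe_compl
  · exact (h m).2 (by simpa [compl] using hm)
  · exact (h m).1 (by simpa [compl] using hm)

lemma adm_shift {w α β : ℕ → Bool} (h : Adm w α β) (m : ℕ) : Adm (shift m w) α β := by
  intro n
  rw [shift_shift]
  exact h (m + n)

/-- A tail of `rho w` at an odd position is never close to the bounds, so `rho` preserves
admissibility. -/
lemma adm_rho {w α β : ℕ → Bool} (h : Adm w α β) (hα0 : α 0 = false) (hα1 : α 1 = true)
    (hβ0 : β 0 = true) (hβ1 : β 1 = false) : Adm (rho w) (rho α) (rho β) := by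
  have key : ∀ {w α : ℕ → Bool} (m : ℕ), α 0 = false → α 1 = true →
      (w m = false → LexLe (shift m w) α) →
      ∀ p, p = 2 * m ∨ p = 2 * m + 1 → rho w p = false → LexLe (shift p (rho w)) (rho α) := by
    intro w α m hα0 hα1 h p hp hw
    have e0 := rho_two_mul α 0
    have e1 := rho_two_mul_add_one α 0
    have e2 := rho_two_mul α 1
    simp only [mul_zero, mul_one, zero_add, hα0, hα1] at e0 e1 e2
    rcases hp with rfl | rfl
    · rw [shift_two_mul_rho]
      exact lexLe_rho (h (by simpa using hw))
    · have s0 : shift (2 * m + 1) (rho w) 0 = false := hw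
      have s1 : shift (2 * m + 1) (rho w) 1 = w (m + 1) := rho_two_mul w (m + 1)
      have s2 : shift (2 * m + 1) (rho w) 2 = !w (m + 1) := rho_two_mul_add_one w (m + 1)
      cases hc : w (m + 1)
      · exact lexLe_of_lt (n := 1) (by intro i hi; interval_cases i; rw [s0, e0])
          (by rw [s1, hc]) (by simpa using e1)
      · exact lexLe_of_lt (n := 2) (by intro i hi; interval_cases i <;> simp [s0, s1, e0, e1, hc])
          (by simp [s2, hc]) e2
  intro p
  have hp : p = 2 * (p / 2) ∨ p = 2 * (p / 2) + 1 := by omega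
  refine ⟨fun hw => key (p / 2) hα0 hα1 (h _).1 p hp hw, fun hw => ?_⟩
  have := key (w := compl w) (α := compl β) (p / 2) (by simp [compl, hβ0]) (by simp [compl, hβ1])
    ((adm_compl h) _).1 p hp (by rw [rho_compl]; simp [compl, hw])
  rw [rho_compl, rho_compl, shift_compl] at this
  simpa using lexLe_compl this

lemma adm_iterate_rho {w α β : ℕ → Bool} (h : Adm w α β) (hα0 : α 0 = false) (hα1 : α 1 = true)
    (hβ0 : β 0 = true) (hβ1 : β 1 = false) (n : ℕ) :
    Adm (rho^[n] w) (rho^[n] α) (rho^[n] β) := by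
  induction n generalizing w α β with
  | zero => exact h
  | succ n ih =>
    simp only [Function.iterate_succ_apply]
    exact ih (adm_rho h hα0 hα1 hβ0 hβ1) ((rho_two_mul α 0).trans hα0)
      ((rho_two_mul_add_one α 0).trans (by simp [hα0])) ((rho_two_mul β 0).trans hβ0)
      ((rho_two_mul_add_one β 0).trans (by simp [hβ0]))

lemma adm_of_rho {w α β : ℕ → Bool} (h : Adm (rho w) (rho α) (rho β)) : Adm w α β := by
  intro m
  have := h (2 * m)
  rw [shift_two_mul_rho, rho_two_mul] at this
  exact ⟨fun hm => lexLe_of_rho (this.1 hm), fun hm => lexLe_of_rho (this.2 hm)⟩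

/-! ### Desubstitution -/

/-- The comparison with the first seven terms `0110 100` of the Thue–Morse sequence, written as a
finite condition on the terms of an admissible sequence. -/
lemma adm_tm_window {w : ℕ → Bool} (h : Adm w tm (compl tm)) (m : ℕ) :
    (w (m + 1) = (!w m) → w (m + 2) = (!w m) →
      w (m + 3) = w m ∧ (w (m + 4) = (!w m) → w (m + 5) = w m ∧
        (w (m + 6) = w m))) := by
  have key : ∀ {w : ℕ → Bool}, (w m = false → LexLe (shift m w) tm) → w m = false →
      w (m + 1) = true → w (m + 2) = true → w (m + 3) = false ∧ (w (m + 4) = true →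
        w (m + 5) = false ∧ w (m + 6) = false) := by
    intro w h h0 h1 h2
    have hl := h h0
    have h3 : w (m + 3) = false := by
      by_contra hc
      have := hl 3 (by intro i hi; interval_cases i <;> simp [shift, tm_zero, tm_one, tm_two, *])
        (by simpa [shift] using hc)
      simp [tm_three] at this
    refine ⟨h3, fun h4 => ?_⟩
    have h5 : w (m + 5) = false := by
      by_contra hc
      have := hl 5 (by
        intro i hi
        interval_cases i <;> simp [shift, tm_zero, tm_one, tm_two, tm_three, tm_four, *])
        (by simpa [shift] using hc)
      simp [tm_five] at this
    refine ⟨h5, ?_⟩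
    by_contra hc
    have := hl 6 (by
      intro i hi
      interval_cases i <;> simp [shift, tm_zero, tm_one, tm_two, tm_three, tm_four, tm_five, *])
      (by simpa [shift] using hc)
    simp [tm_six] at this
  intro h1 h2
  cases hm : w m
  · have := key (h m).1 hm (by simpa [hm] using h1) (by simpa [hm] using h2)
    simpa using this
  · have := key (w := compl w) (by simpa using ((adm_compl h) m).1) (by simp [compl, hm])
      (by simp [compl, h1, hm]) (by simp [compl, h2, hm])
    simpa [compl] using this

/-- From an occurrence of `011` or `100` on, an admissible sequence consists of blocks `01` and
`10`. The window condition forces `0110` or `1001`, and then the same situation recurs one or two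
blocks later. -/
lemma alternating_of_adm {w : ℕ → Bool} (h : Adm w tm (compl tm)) {i : ℕ}
    (h1 : w (i + 1) = !w i) (h2 : w (i + 2) = !w i) :
    ∀ t, w (i + (2 * t + 1)) = !w (i + 2 * t) := by
  intro t
  induction t using Nat.strong_induction_on generalizing i with
  | _ t ih =>
    have a := adm_tm_window h i h1 h2
    match t with
    | 0 => exact h1
    | 1 => rw [show i + (2 * 1 + 1) = i + 3 by ring, show i + 2 * 1 = i + 2 by ring, a.1, h2]; simp
    | t + 2 =>
      have b := adm_tm_window h (i + 2)
      have c := adm_tm_window h (i + 1)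
      simp only [add_assoc, Nat.reduceAdd] at b c
      by_cases h4 : w (i + 4) = w i
      · have := ih (t + 1) (by omega) (i := i + 2) (by rw [add_assoc, a.1, h2]; simp)
          (by rw [add_assoc, h4, h2]; simp)
        convert this using 2 <;> [skip; congr 1] <;> ring
      · have h4' : w (i + 4) = !w i := by revert h4; cases w (i + 4) <;> cases w i <;> simp
        obtain ⟨h5, h6⟩ := a.2 h4'
        have := ih t (by omega) (i := i + 4) (by rw [add_assoc, h5, h4']; simp)
          (by rw [add_assoc, h6, h4']; simp)
        convert this using 2 <;> [skip; congr 1] <;> ring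

/-- An admissible sequence is constant or has a tail that is the image under `rho` of an
admissible sequence. -/
lemma adm_tm_cases {w : ℕ → Bool} (h : Adm w tm (compl tm)) :
    (∀ i, w i = w 0) ∨ ∃ m z, shift m w = rho z ∧ Adm z tm (compl tm) := by
  have hfin : ∀ m, (∀ t, w (m + (2 * t + 1)) = !w (m + 2 * t)) →
      ∃ m z, shift m w = rho z ∧ Adm z tm (compl tm) := by
    intro m hm
    have e := eq_rho_of_alternating (w := shift m w) hm
    refine ⟨m, _, e, adm_of_rho ?_⟩
    rw [← e, rho_compl, rho_tm]
    exact adm_shift h m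
  by_cases hconst : ∀ i, w (i + 1) = w i
  · left
    intro i
    induction i with
    | zero => rfl
    | succ i ih => rw [hconst, ih]
  right
  push Not at hconst
  obtain ⟨i, hi⟩ := hconst
  have hi : w (i + 1) = !w i := by revert hi; cases w (i + 1) <;> cases w i <;> simp
  by_cases hs : ∃ j, w (j + 1) = (!w j) ∧ w (j + 2) = !w j
  · obtain ⟨j, hj1, hj2⟩ := hs
    exact hfin j (alternating_of_adm h hj1 hj2)
  · have halt : ∀ t, w (i + (t + 1)) = !w (i + t) := by
      intro t
      induction t with
      | zero => exact hi
      | succ t ih =>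
        by_contra hc
        refine hs ⟨i + t, by rw [add_assoc, ih], ?_⟩
        have : w (i + t + 2) = w (i + (t + 1)) := by
          rw [show i + t + 2 = i + (t + 1 + 1) by ring]
          revert hc; cases w (i + (t + 1 + 1)) <;> cases w (i + (t + 1)) <;> simp
        rw [this, ih]
    exact hfin i fun t => halt (2 * t)

/-! ### Values of binary sequences -/

/-- The real number whose base `k` digits are `0` and `k - 1`, at the positions where `w` is `0`
and `1`. For `k = 2` this is the binary value of `w`. -/
noncomputable def val (k : ℕ) (w : ℕ → Bool) : ℝ :=
  ∑' i, if w i then ((k : ℝ) - 1) / (k : ℝ) ^ (i + 1) else 0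

lemma hasSum_ones {k : ℕ} (hk : 2 ≤ k) :
    HasSum (fun i : ℕ => ((k : ℝ) - 1) / (k : ℝ) ^ (i + 1)) 1 := by
  have hk' : (2 : ℝ) ≤ k := by exact_mod_cast hk
  have h := (hasSum_geometric_of_lt_one (r := (k : ℝ)⁻¹) (by positivity)
    (inv_lt_one_of_one_lt₀ (by linarith))).mul_left (((k : ℝ) - 1) / k)
  have e : ((k : ℝ) - 1) / k * (1 - (k : ℝ)⁻¹)⁻¹ = 1 := by
    have : (k : ℝ) - 1 ≠ 0 := by linarith
    field_simp
  rw [e] at h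
  have e2 : (fun i : ℕ => ((k : ℝ) - 1) / (k : ℝ) ^ (i + 1))
      = fun i => ((k : ℝ) - 1) / k * (k : ℝ)⁻¹ ^ i := by
    funext i
    rw [inv_pow, pow_succ]
    field_simp
  rw [e2]
  exact h

lemma summable_val {k : ℕ} (hk : 2 ≤ k) (w : ℕ → Bool) :
    Summable fun i => if w i then ((k : ℝ) - 1) / (k : ℝ) ^ (i + 1) else 0 := by
  have hk' : (2 : ℝ) ≤ k := by exact_mod_cast hk
  refine Summable.of_nonneg_of_le (fun i => ?_) (fun i => ?_) (hasSum_ones hk).summable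
  · have : 0 ≤ ((k : ℝ) - 1) / (k : ℝ) ^ (i + 1) := div_nonneg (by linarith) (by positivity)
    split_ifs <;> simp [this]
  · have : 0 ≤ ((k : ℝ) - 1) / (k : ℝ) ^ (i + 1) := div_nonneg (by linarith) (by positivity)
    split_ifs <;> simp [this]

lemma val_nonneg {k : ℕ} (hk : 2 ≤ k) (w : ℕ → Bool) : 0 ≤ val k w := by
  have hk' : (2 : ℝ) ≤ k := by exact_mod_cast hk
  refine tsum_nonneg fun i => ?_
  have : 0 ≤ ((k : ℝ) - 1) / (k : ℝ) ^ (i + 1) := div_nonneg (by linarith) (by positivity)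
  split_ifs <;> simp [this]

lemma val_compl {k : ℕ} (hk : 2 ≤ k) (w : ℕ → Bool) : val k (compl w) = 1 - val k w := by
  rw [eq_sub_iff_add_eq, val, val, ← (summable_val hk _).tsum_add (summable_val hk _)]
  refine Eq.trans ?_ (hasSum_ones hk).tsum_eq
  congr 1; funext i
  cases h : w i <;> simp [compl, h]

lemma val_le_one {k : ℕ} (hk : 2 ≤ k) (w : ℕ → Bool) : val k w ≤ 1 := by
  have := val_nonneg hk (compl w)
  rw [val_compl hk] at this
  linarith

lemma val_step {k : ℕ} (hk : 2 ≤ k) (w : ℕ → Bool) :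
    val k w = ((if w 0 then ((k : ℝ) - 1) else 0) + val k (shift 1 w)) / k := by
  have hk' : (2 : ℝ) ≤ k := by exact_mod_cast hk
  rw [val, (summable_val hk w).tsum_eq_zero_add, add_div, val, ← tsum_div_const]
  congr 1
  · split_ifs <;> simp
  · congr 1; funext i
    simp only [shift, add_comm 1 i, pow_succ]
    split_ifs
    · field_simp
    · simp

lemma val_sub_of_agree {k : ℕ} (hk : 2 ≤ k) {w z : ℕ → Bool} {n : ℕ} (h : ∀ i < n, w i = z i) :
    val k w - val k z = (val k (shift n w) - val k (shift n z)) / (k : ℝ) ^ n := by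
  have hk' : (2 : ℝ) ≤ k := by exact_mod_cast hk
  induction n with
  | zero => simp [shift_zero]
  | succ n ih =>
    rw [ih fun i hi => h i (by omega), val_step hk (shift n w), val_step hk (shift n z),
      shift_shift, shift_shift]
    have : shift n w 0 = shift n z 0 := h n (by omega)
    rw [this, pow_succ]
    field_simp
    ring

lemma val_sub_le {k : ℕ} (hk : 2 ≤ k) {w z : ℕ → Bool} {n : ℕ} (h : ∀ i < n, w i = z i) :
    val k w - val k z ≤ 1 / (k : ℝ) ^ n := by
  rw [val_sub_of_agree hk h]
  gcongr
  linarith [val_le_one hk (shift n w), val_nonneg hk (shift n z)]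

lemma abs_val_sub_le {k : ℕ} (hk : 2 ≤ k) {w z : ℕ → Bool} {n : ℕ} (h : ∀ i < n, w i = z i) :
    |val k w - val k z| ≤ 1 / (k : ℝ) ^ n :=
  abs_sub_le_iff.mpr ⟨val_sub_le hk h, val_sub_le hk fun i hi => (h i hi).symm⟩

lemma le_val_of_one {k : ℕ} (hk : 2 ≤ k) {w : ℕ → Bool} (h : w 0 = true) :
    ((k : ℝ) - 1) / k ≤ val k w := by
  rw [val_step hk, h]
  gcongr
  simpa using val_nonneg hk _

lemma val_le_of_zero {k : ℕ} (hk : 2 ≤ k) {w : ℕ → Bool} (h : w 0 = false) :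
    val k w ≤ 1 / k := by
  rw [val_step hk, h]
  gcongr
  simpa using val_le_one hk _

/-- For `k ≥ 3` the values of sequences with leading terms `1` and `0` are at least `1 / k`
apart. -/
lemma le_val_sub {k : ℕ} (hk : 3 ≤ k) {w z : ℕ → Bool} {n : ℕ} (h : ∀ i < n, w i = z i)
    (hw : w n = true) (hz : z n = false) : 1 / (k : ℝ) ^ (n + 1) ≤ val k w - val k z := by
  have hk' : (3 : ℝ) ≤ k := by exact_mod_cast hk
  rw [val_sub_of_agree (by omega) h, pow_succ, mul_comm, ← div_div]
  gcongr
  have h1 := le_val_of_one (k := k) (w := shift n w) (by omega) hw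
  have h2 := val_le_of_zero (k := k) (w := shift n z) (by omega) hz
  have h3 : ((k : ℝ) - 1) / k - 1 / k = ((k : ℝ) - 2) / k := by field_simp; ring
  have h4 : 1 / (k : ℝ) ≤ ((k : ℝ) - 2) / k := by gcongr; linarith
  linarith

lemma le_abs_val_sub {k : ℕ} (hk : 3 ≤ k) {w z : ℕ → Bool} {n : ℕ} (h : ∀ i < n, w i = z i)
    (hne : w n ≠ z n) : 1 / (k : ℝ) ^ (n + 1) ≤ |val k w - val k z| := by
  cases hw : w n
  · rw [abs_sub_comm]
    exact (le_val_sub hk (fun i hi => (h i hi).symm) (by revert hne; simp [hw]) hw).trans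
      (le_abs_self _)
  · exact (le_val_sub hk h hw (by revert hne; simp [hw])).trans (le_abs_self _)

lemma val_injective {k : ℕ} (hk : 3 ≤ k) : Function.Injective (val k) := by
  intro w z h
  by_contra hne
  obtain ⟨n, hn, hd⟩ := exists_first_diff hne
  have := le_abs_val_sub hk hn hd
  rw [h, sub_self, abs_zero] at this
  have h2 : 0 < 1 / (k : ℝ) ^ (n + 1) := by
    have : (0 : ℝ) < k := by exact_mod_cast (by omega : 0 < k)
    positivity
  linarith

lemma val_mono {k : ℕ} (hk : 2 ≤ k) {w z : ℕ → Bool} (h : LexLe w z) : val k w ≤ val k z := by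
  have hk' : (2 : ℝ) ≤ k := by exact_mod_cast hk
  by_cases hwz : w = z
  · rw [hwz]
  obtain ⟨n, hn, hne⟩ := exists_first_diff hwz
  have h1 := h n hn
  have hw : w n = false := by revert h1 hne; cases w n <;> cases z n <;> simp
  have hz : z n = true := by revert h1 hne; cases w n <;> cases z n <;> simp
  have h2 := val_le_of_zero (w := shift n w) hk hw
  have h3 := le_val_of_one (w := shift n z) hk hz
  have h4 : 1 / (k : ℝ) ≤ ((k : ℝ) - 1) / k := by gcongr; linarith
  have h5 : val k w - val k z ≤ 0 := by
    rw [val_sub_of_agree hk hn]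
    exact div_nonpos_of_nonpos_of_nonneg (by linarith) (by positivity)
  linarith

lemma lexLe_of_val_le {k : ℕ} (hk : 3 ≤ k) {w z : ℕ → Bool} (h : val k w ≤ val k z) :
    LexLe w z := by
  have hk' : (3 : ℝ) ≤ k := by exact_mod_cast hk
  intro n hn hw
  by_contra hz
  have := le_val_sub hk hn hw (by simpa using hz)
  have h2 : 0 < 1 / (k : ℝ) ^ (n + 1) := by positivity
  linarith

lemma val_lt_one {k : ℕ} (hk : 2 ≤ k) {w : ℕ → Bool} {n : ℕ} (h : w n = false) :
    val k w < 1 := by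
  have hk' : (2 : ℝ) ≤ k := by exact_mod_cast hk
  have h1 : 0 < val k (compl w) := by
    refine (summable_val hk _).tsum_pos (fun i => ?_) n ?_
    · have : 0 ≤ ((k : ℝ) - 1) / (k : ℝ) ^ (i + 1) := div_nonneg (by linarith) (by positivity)
      split_ifs <;> simp [this]
    · simp only [compl, h, Bool.not_false, if_true]
      exact div_pos (by linarith) (by positivity)
  rw [val_compl hk] at h1
  linarith

/-- A sequence that is not eventually constant is determined by its value, also in base two. -/
lemma eq_of_val_eq {k : ℕ} (hk : 2 ≤ k) {w z : ℕ → Bool} (h : val k w = val k z)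
    (hz : ∀ b n, ∃ m ≥ n, z m = b) : w = z := by
  have hk' : (2 : ℝ) ≤ k := by exact_mod_cast hk
  have key : ∀ {w z : ℕ → Bool}, val k w = val k z → (∀ b n, ∃ m ≥ n, z m = b) →
      ∀ n, (∀ i < n, w i = z i) → w n = false → z n = true → False := by
    intro w z h hz n hn hw hzn
    obtain ⟨m, hm, hzm⟩ := hz true (n + 1)
    have h0 := val_sub_of_agree hk hn
    rw [h, sub_self, eq_comm, div_eq_zero_iff, or_iff_left (by positivity), sub_eq_zero] at h0
    rw [val_step hk (shift n w), val_step hk (shift n z), shift_shift, shift_shift,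
      div_left_inj' (by positivity)] at h0
    have e1 : shift n w 0 = false := hw
    have e2 : shift n z 0 = true := hzn
    have h1 := val_le_one hk (shift (n + 1) w)
    have h2 := val_lt_one (k := k) hk (w := compl (shift (n + 1) z)) (n := m - (n + 1))
      (by simp only [compl, shift]; rw [Nat.add_sub_cancel' hm, hzm]; rfl)
    rw [val_compl hk] at h2
    simp only [e1, e2, Bool.false_eq_true, if_false, if_true] at h0
    linarith
  by_contra hne
  obtain ⟨n, hn, hd⟩ := exists_first_diff hne
  cases hw : w n
  · exact key h hz n hn hw (by revert hd; simp [hw])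
  · refine key (w := compl w) (z := compl z) (by rw [val_compl hk, val_compl hk, h])
      (fun b m => ?_) n (fun i hi => by simp [compl, hn i hi]) (by simp [compl, hw])
      (by revert hd; simp [hw, compl])
    obtain ⟨p, hp, e⟩ := hz (!b) m
    exact ⟨p, hp, by simp [compl, e]⟩

/-- A bounded orbit that follows the itinerary `w` starts at the value of `w`. -/
lemma eq_val_of_orbit {k : ℕ} (hk : 2 ≤ k) {w : ℕ → Bool} {y : ℕ → ℝ}
    (hy : ∀ n, y n ∈ Set.Icc (0 : ℝ) 1)
    (hs : ∀ n, y n = ((if w n then ((k : ℝ) - 1) else 0) + y (n + 1)) / k) : y 0 = val k w := by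
  have hk' : (2 : ℝ) ≤ k := by exact_mod_cast hk
  have h : ∀ n, y 0 - val k w = (y n - val k (shift n w)) / (k : ℝ) ^ n := by
    intro n
    induction n with
    | zero => simp [shift_zero]
    | succ n ih =>
      rw [ih, val_step hk (shift n w), shift_shift, hs n, pow_succ]
      simp only [shift, add_zero]
      field_simp
      ring
  have hb : ∀ n, |y 0 - val k w| ≤ (1 / (k : ℝ)) ^ n := by
    intro n
    rw [h n, abs_div, abs_of_pos (by positivity : (0 : ℝ) < (k : ℝ) ^ n), div_pow, one_pow]
    gcongr
    rw [abs_le]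
    constructor <;> linarith [(hy n).1, (hy n).2, val_nonneg hk (shift n w),
      val_le_one hk (shift n w)]
  have ht : Filter.Tendsto (fun n : ℕ => (1 / (k : ℝ)) ^ n) Filter.atTop (nhds 0) :=
    tendsto_pow_atTop_nhds_zero_of_lt_one (by positivity)
      (by rw [div_lt_one (by positivity)]; linarith)
  have := ge_of_tendsto' ht hb
  exact sub_eq_zero.mp (abs_nonpos_iff.mp this)

/-! ### The expanding map on values -/

lemma expandingMap_mem (k : ℕ) (x : ℝ) : expandingMap k x ∈ Set.Ico (0 : ℝ) 1 :=
  ⟨Int.fract_nonneg _, Int.fract_lt_one _⟩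

lemma iterate_expandingMap_mem (k : ℕ) {x : ℝ} (hx : x ∈ Set.Ico (0 : ℝ) 1) (n : ℕ) :
    (expandingMap k)^[n] x ∈ Set.Ico (0 : ℝ) 1 := by
  cases n with
  | zero => exact hx
  | succ n => rw [Function.iterate_succ_apply']; exact expandingMap_mem _ _

lemma iterate_expandingMap_eq (k : ℕ) {x : ℝ} (hx : x ∈ Set.Ico (0 : ℝ) 1) (n : ℕ) :
    (expandingMap k)^[n] x = Int.fract ((k : ℝ) ^ n * x) := by
  induction n with
  | zero => simpa using (Int.fract_eq_self.mpr hx).symm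
  | succ n ih =>
    rw [Function.iterate_succ_apply', ih, expandingMap, Int.fract_eq_fract]
    refine ⟨-(k * ⌊(k : ℝ) ^ n * x⌋), ?_⟩
    rw [Int.fract, pow_succ]
    push_cast
    ring

/-- The digits of `x` are read off from its orbit. -/
lemma kDigit_eq {k : ℕ} (hk : 2 ≤ k) {x : ℝ} (hx : x ∈ Set.Ico (0 : ℝ) 1) (n : ℕ) :
    kDigit k x n = ⌊(k : ℝ) * (expandingMap k)^[n] x⌋₊ := by
  have hk' : (2 : ℝ) ≤ k := by exact_mod_cast hk
  have hx0 := hx.1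
  rw [iterate_expandingMap_eq k hx, kDigit]
  have h0 : 0 ≤ (k : ℝ) ^ n * x := by positivity
  have hf : 0 ≤ (k : ℝ) * Int.fract ((k : ℝ) ^ n * x) :=
    mul_nonneg (by positivity) (Int.fract_nonneg _)
  have e : (k : ℝ) ^ (n + 1) * x
      = (k : ℝ) * Int.fract ((k : ℝ) ^ n * x) + ((k * ⌊(k : ℝ) ^ n * x⌋₊ : ℕ) : ℝ) := by
    have : Int.fract ((k : ℝ) ^ n * x) = (k : ℝ) ^ n * x - ⌊(k : ℝ) ^ n * x⌋₊ := by
      rw [Int.fract, natCast_floor_eq_intCast_floor h0]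
    rw [this, pow_succ]
    push_cast
    ring
  rw [e, Nat.floor_add_natCast hf, Nat.add_mul_mod_self_left]
  refine Nat.mod_eq_of_lt ((Nat.floor_lt hf).mpr ?_)
  have := Int.fract_lt_one ((k : ℝ) ^ n * x)
  nlinarith

lemma expandingMap_step {k : ℕ} (hk : 2 ≤ k) {y : ℝ} (hy : y ∈ Set.Ico (0 : ℝ) 1) :
    y = ((⌊(k : ℝ) * y⌋₊ : ℝ) + expandingMap k y) / k := by
  have hk' : (2 : ℝ) ≤ k := by exact_mod_cast hk
  have hy0 := hy.1
  rw [expandingMap, Int.fract, natCast_floor_eq_intCast_floor (by positivity)]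
  field_simp
  ring

/-- A point of `[0,1)` all of whose digits are `0` or `k - 1`. -/
lemma eq_val_of_digits {k : ℕ} (hk : 2 ≤ k) {x : ℝ} (hx : x ∈ Set.Ico (0 : ℝ) 1) {w : ℕ → Bool}
    (h : ∀ n, kDigit k x n = if w n then k - 1 else 0) (n : ℕ) :
    (expandingMap k)^[n] x = val k (shift n w) := by
  refine eq_val_of_orbit hk (y := fun i => (expandingMap k)^[n + i] x)
    (fun i => Set.Ico_subset_Icc_self (iterate_expandingMap_mem k hx _)) (fun i => ?_)
  have h1 := expandingMap_step hk (iterate_expandingMap_mem k hx (n + i))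
  rw [← kDigit_eq hk hx, h, ← Function.iterate_succ_apply' (expandingMap k)] at h1
  rw [h1]
  cases hw : w (n + i) <;> simp [shift, hw, Nat.cast_sub (by omega : 1 ≤ k), add_assoc]

lemma exists_val_two_eq {x : ℝ} (hx : x ∈ Set.Ico (0 : ℝ) 1) : ∃ w, val 2 w = x := by
  refine ⟨fun n => decide (kDigit 2 x n = 1), ?_⟩
  rw [← shift_zero (fun n => _), ← eq_val_of_digits le_rfl hx (w := fun n => _) _ 0]
  · rfl
  · intro n
    have : kDigit 2 x n < 2 := Nat.mod_lt _ two_pos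
    interval_cases kDigit 2 x n <;> simp

lemma expandingMap_val {k : ℕ} (hk : 2 ≤ k) {w : ℕ → Bool} (h : val k (shift 1 w) < 1) :
    expandingMap k (val k w) = val k (shift 1 w) := by
  have hk' : (2 : ℝ) ≤ k := by exact_mod_cast hk
  have e : (k : ℝ) * val k w = val k (shift 1 w) + ((if w 0 then k - 1 else 0 : ℤ) : ℝ) := by
    rw [val_step hk w]
    split_ifs <;> push_cast <;> field_simp <;> ring
  rw [expandingMap, e, Int.fract_add_intCast, Int.fract_eq_self.mpr ⟨val_nonneg hk _, h⟩]

/-- The orbit of a value follows the tails, up to the double expansion of `k`-adic rationals. -/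
lemma iterate_expandingMap_val {k : ℕ} (hk : 2 ≤ k) (w : ℕ → Bool) (n : ℕ) :
    (expandingMap k)^[n] (val k w) = val k (shift n w) ∨ (expandingMap k)^[n] (val k w) = 0 := by
  have hk' : (2 : ℝ) ≤ k := by exact_mod_cast hk
  induction n with
  | zero => left; simp [shift_zero]
  | succ n ih =>
    rw [Function.iterate_succ_apply']
    rcases ih with h | h <;> rw [h]
    · rcases (val_le_one hk (shift (n + 1) w)).lt_or_eq with h1 | h1
      · left; rw [expandingMap_val hk (by rwa [shift_shift]), shift_shift]
      · right
        have e : (k : ℝ) * val k (shift n w)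
            = (((if w n then (k : ℤ) - 1 else 0) + 1 : ℤ) : ℝ) := by
          rw [val_step hk, shift_shift, h1, mul_div_cancel₀ _ (by positivity)]
          cases hw : w n <;> simp [shift, hw]
        rw [expandingMap, e, Int.fract_intCast]
    · right; simp [expandingMap]

lemma kDigit_val {k : ℕ} (hk : 2 ≤ k) {w : ℕ → Bool} (hw : ∀ n, ∃ m ≥ n, w m = false) (n : ℕ) :
    kDigit k (val k w) n = if w n then k - 1 else 0 := by
  have hk' : (2 : ℝ) ≤ k := by exact_mod_cast hk
  have hlt : ∀ n, val k (shift n w) < 1 := by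
    intro n
    obtain ⟨m, hm, h⟩ := hw n
    exact val_lt_one hk (n := m - n) (by simp only [shift]; rwa [Nat.add_sub_cancel' hm])
  have horb : ∀ n, (expandingMap k)^[n] (val k w) = val k (shift n w) := by
    intro n
    induction n with
    | zero => simp [shift_zero]
    | succ n ih =>
      rw [Function.iterate_succ_apply', ih,
        expandingMap_val hk (by rw [shift_shift]; exact hlt _), shift_shift]
  have h0 : val k w ∈ Set.Ico (0 : ℝ) 1 := ⟨val_nonneg hk w, by simpa [shift_zero] using hlt 0⟩
  rw [kDigit_eq hk h0, horb, val_step hk, shift_shift]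
  rw [mul_div_cancel₀ _ (by positivity)]
  have e : (if shift n w 0 then ((k : ℝ) - 1) else 0)
      = ((if w n then k - 1 else 0 : ℕ) : ℝ) := by
    simp only [shift, add_zero]
    split_ifs <;> simp [Nat.cast_sub (by omega : 1 ≤ k)]
  rw [e, add_comm, Nat.floor_add_natCast (val_nonneg hk _),
    Nat.floor_eq_zero.mpr (hlt _), zero_add]

/-! ### The generalized Cantor function at the Thue–Morse constant -/

lemma val_tm_lt_one {k : ℕ} (hk : 2 ≤ k) : val k tm < 1 := val_lt_one hk tm_zero

lemma thueMorseConst_eq : thueMorseConst = val 2 tm := by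
  rw [thueMorseConst, val]
  congr 1; funext n
  have := thueMorse_lt_two n
  obtain h | h : thueMorse n = 0 ∨ thueMorse n = 1 := by omega
  · simp [tm, h]
  · simp [tm, h]
    norm_num

lemma kExpansion_of_lt {k : ℕ} {x : ℝ} (hx : x < 1) : kExpansion k x = kDigit k x := by
  funext n; simp [kExpansion, hx]

/-- If all digits of `x` are `0` or `k - 1`, then `g_k` replaces the base `k` by two. -/
lemma cantorFun_of_digits {k : ℕ} (hk : 2 ≤ k) {x : ℝ} {w : ℕ → Bool}
    (h : ∀ n, kExpansion k x n = if w n then k - 1 else 0) : cantorFun k x = val 2 w := by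
  have hk' : (2 : ℝ) ≤ k := by exact_mod_cast hk
  have hn : ¬ ∃ n, kExpansion k x n ≠ 0 ∧ kExpansion k x n ≠ k - 1 := by
    rintro ⟨n, h1, h2⟩
    rw [h] at h1 h2
    cases hw : w n <;> simp [hw] at h1 h2
  rw [cantorFun, dif_neg hn, val]
  congr 1; funext n
  rw [h]
  have h1 : (k : ℝ) - 1 ≠ 0 := by linarith
  cases hw : w n
  · simp
  · simp only [if_true, Nat.cast_sub (by omega : 1 ≤ k)]
    push_cast
    field_simp
    norm_num

/-- In every case `g_k(x)` is the binary value of a sequence, which is eventually zero if some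
digit of `x` is neither `0` nor `k - 1`. -/
lemma cantorFun_eq_val {k : ℕ} (hk : 2 ≤ k) (x : ℝ) : ∃ w, cantorFun k x = val 2 w ∧
    ((∀ n, kExpansion k x n = if w n then k - 1 else 0) ∨ ∃ N, ∀ n ≥ N, w n = false) := by
  classical
  have hk' : (2 : ℝ) ≤ k := by exact_mod_cast hk
  have h1 : (k : ℝ) - 1 ≠ 0 := by linarith
  by_cases h : ∃ n, kExpansion k x n ≠ 0 ∧ kExpansion k x n ≠ k - 1
  · let N := Nat.find h
    refine ⟨fun n => decide ((n < N ∧ kExpansion k x n = k - 1) ∨ n = N), ?_,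
      Or.inr ⟨N + 1, fun n hn => by simp; omega⟩⟩
    rw [cantorFun, dif_pos h, val, tsum_eq_sum (s := Finset.range (N + 1)),
      Finset.sum_range_succ]
    · congr 1
      · refine Finset.sum_congr (by congr!) fun n hn => ?_
        have hn' : n < N := Finset.mem_range.mp hn
        have hmin := Nat.find_min h hn'
        by_cases h0 : kExpansion k x n = k - 1
        · simp only [h0, hn', true_and, true_or, decide_true, if_true,
            Nat.cast_sub (by omega : 1 ≤ k)]
          push_cast
          field_simp
          norm_num
        · have h00 : kExpansion k x n = 0 := by tauto
          simp [h00, hn'.ne, (show (0 : ℕ) ≠ k - 1 by omega)]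
      · simp only [or_true, decide_true, if_true]
        norm_num
        congr!
    · intro n hn
      have : N + 1 ≤ n := by simpa using hn
      simp only [show ¬ n < N by omega, show n ≠ N by omega]
      simp
  · push Not at h
    have hw : ∀ n, kExpansion k x n
        = if (decide (kExpansion k x n = k - 1)) then k - 1 else 0 := by
      intro n
      by_cases h0 : kExpansion k x n = k - 1
      · simp [h0]
      · rw [if_neg (by simpa using h0)]
        by_contra hc
        exact h0 (h n hc)
    exact ⟨_, cantorFun_of_digits hk hw, Or.inl hw⟩

lemma cantorFun_val_tm {k : ℕ} (hk : 2 ≤ k) : cantorFun k (val k tm) = thueMorseConst := by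
  rw [thueMorseConst_eq]
  refine cantorFun_of_digits hk fun n => ?_
  rw [kExpansion_of_lt (val_tm_lt_one hk)]
  exact kDigit_val hk (exists_tm_eq false) n

lemma eq_val_tm_of_cantorFun {k : ℕ} (hk : 2 ≤ k) {x : ℝ} (hx : x ∈ Set.Icc (0 : ℝ) 1)
    (h : cantorFun k x = thueMorseConst) : x = val k tm := by
  obtain ⟨w, hw, hd⟩ := cantorFun_eq_val hk x
  rw [h, thueMorseConst_eq] at hw
  obtain rfl := eq_of_val_eq le_rfl hw.symm exists_tm_eq
  rcases hd with hd | ⟨N, hN⟩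
  · have hx1 : x < 1 := by
      by_contra hc
      have := hd 0
      simp [kExpansion, hc, tm_zero] at this
      omega
    rw [kExpansion_of_lt hx1] at hd
    simpa [shift_zero] using eq_val_of_digits hk ⟨hx.1, hx1⟩ hd 0
  · obtain ⟨m, hm, e⟩ := exists_tm_eq true N
    simp [hN m hm] at e

/-! ### Hölder maps and dimension -/

lemma holderOnWith_of_dist {f : ℝ → ℝ} {s : Set ℝ} {C r : ℝ≥0}
    (h : ∀ x ∈ s, ∀ y ∈ s, |f x - f y| ≤ C * |x - y| ^ (r : ℝ)) : HolderOnWith C r f s := by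
  intro x hx y hy
  rw [edist_dist, edist_dist, Real.dist_eq, Real.dist_eq,
    ENNReal.ofReal_rpow_of_nonneg (abs_nonneg _) r.coe_nonneg, ← ENNReal.ofReal_coe_nnreal,
    ← ENNReal.ofReal_mul C.coe_nonneg]
  exact ENNReal.ofReal_le_ofReal (h x hx y hy)

/-- If a set of values is coded so that its itineraries contain an arbitrary binary sequence along
an arithmetic progression, the binary value of that sequence is a Hölder function on the set, onto
`[0,1]`; hence the dimension is positive. -/
lemma dimH_range_val_pos {k : ℕ} (hk : 3 ≤ k) {L : ℕ} {F : (ℕ → Bool) → ℕ → Bool}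
    (hF : ∀ x y i, F x (L * i) = F y (L * i) → x i = y i) :
    0 < dimH (Set.range fun x => val k (F x)) := by
  have hk' : (3 : ℝ) ≤ k := by exact_mod_cast hk
  have hinj : Function.Injective fun x => val k (F x) := by
    intro x y h
    have := val_injective hk h
    funext i
    exact hF x y i (by rw [this])
  set S := Set.range fun x => val k (F x)
  let f : ℝ → ℝ := fun s => val 2 (Function.invFun (fun x => val k (F x)) s)
  have hf : ∀ x, f (val k (F x)) = val 2 x := fun x =>
    congrArg (val 2) (Function.leftInverse_invFun hinj x)
  have hbase : 1 < (k : ℝ) ^ (L + 1) := one_lt_pow₀ (by linarith) (by omega)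
  let r : ℝ≥0 := ⟨Real.logb ((k : ℝ) ^ (L + 1)) 2, (Real.logb_pos hbase one_lt_two).le⟩
  have hr : 0 < r := Real.logb_pos hbase one_lt_two
  have hpow : ((k : ℝ) ^ (L + 1)) ^ (r : ℝ) = 2 :=
    Real.rpow_logb (by linarith) hbase.ne' two_pos
  have hh : HolderOnWith 2 r f S := by
    refine holderOnWith_of_dist ?_
    rintro _ ⟨x, rfl⟩ _ ⟨y, rfl⟩
    simp only [hf]
    by_cases hxy : x = y
    · subst hxy
      simp only [sub_self, abs_zero]
      positivity
    obtain ⟨m, hm, hd⟩ := exists_first_diff hxy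
    have hFd : F x (L * m) ≠ F y (L * m) := fun h => hd (hF x y m h)
    obtain ⟨p, hp, hpd⟩ := exists_first_diff (fun h => hFd (congrFun h _) : F x ≠ F y)
    have hpm : p ≤ L * m := by
      by_contra hc
      exact hFd (hp _ (by omega))
    have h1 := le_abs_val_sub hk hp hpd
    have h2 := abs_val_sub_le (k := 2) le_rfl hm
    have h3 : (1 / (k : ℝ) ^ (L + 1)) ^ (m + 1) ≤ |val k (F x) - val k (F y)| := by
      refine le_trans ?_ h1
      rw [div_pow, one_pow, ← pow_mul]
      gcongr
      · linarith
      · nlinarith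
    have h4 : ((1 / (k : ℝ) ^ (L + 1)) ^ (m + 1)) ^ (r : ℝ) = (1 / 2) ^ (m + 1) := by
      rw [← Real.rpow_natCast, ← Real.rpow_mul (by positivity), mul_comm,
        Real.rpow_mul (by positivity), Real.rpow_natCast, Real.div_rpow zero_le_one
        (by positivity), Real.one_rpow, hpow]
    have h5 : ((1 / (k : ℝ) ^ (L + 1)) ^ (m + 1)) ^ (r : ℝ)
        ≤ |val k (F x) - val k (F y)| ^ (r : ℝ) := Real.rpow_le_rpow (by positivity) h3 r.coe_nonneg
    rw [h4, pow_succ, div_pow, one_pow] at h5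
    push_cast at h2 ⊢
    linarith
  have him : Set.Ico (0 : ℝ) 1 ⊆ f '' S := by
    intro t ht
    obtain ⟨x, rfl⟩ := exists_val_two_eq ht
    exact ⟨_, ⟨x, rfl⟩, hf x⟩
  have hone : dimH (Set.Ico (0 : ℝ) 1) = 1 := by
    rw [Real.dimH_of_nonempty_interior (by simp)]; simp
  have hle := (dimH_mono him).trans (hh.dimH_image_le hr)
  rw [hone] at hle
  rw [pos_iff_ne_zero]
  intro h0
  rw [h0, ENNReal.zero_div] at hle
  simp at hle

/-- Values of sequences whose tails avoid the hole `(a,b)` are survivors; an orbit that leaves the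
tails is stuck at `0`, which is outside the hole as `0 ≤ a`. -/
lemma val_mem_survivorSet {k : ℕ} (hk : 2 ≤ k) {a b : ℝ} (ha : 0 ≤ a) {w : ℕ → Bool}
    (hw : ∀ m, val k (shift m w) ∉ Set.Ioo a b) (h1 : val k w ≠ 1) :
    val k w ∈ survivorSet k a b := by
  refine ⟨⟨val_nonneg hk w, lt_of_le_of_ne (val_le_one hk w) h1⟩, fun n => ?_⟩
  rcases iterate_expandingMap_val hk w n with h | h <;> rw [h]
  · exact hw n
  · exact fun hc => absurd hc.1 (not_lt.mpr ha)

lemma survivorDim_pos {k : ℕ} (hk : 3 ≤ k) {a b : ℝ} (ha : 0 ≤ a) {L : ℕ}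
    {F : (ℕ → Bool) → ℕ → Bool} (hF : ∀ x y i, F x (L * i) = F y (L * i) → x i = y i)
    (hav : ∀ x m, val k (shift m (F x)) ∉ Set.Ioo a b) : 0 < survivorDim k a b := by
  have h := dimH_range_val_pos hk hF
  have hsub : (Set.range fun x => val k (F x)) ⊆ survivorSet k a b ∪ {1} := by
    rintro _ ⟨x, rfl⟩
    by_cases h1 : val k (F x) = 1
    · exact Or.inr h1
    · exact Or.inl (val_mem_survivorSet (by omega) ha (hav x) h1)
  have h2 := h.trans_le (dimH_mono hsub)
  rw [dimH_union, dimH_singleton] at h2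
  simpa [survivorDim] using h2

/-! ### The symmetric hole at the Thue–Morse point -/

/-- A map that doubles the length of common prefixes is Hölder of exponent two on values. -/
lemma dimH_val_rho_le {k : ℕ} (hk : 3 ≤ k) (A : Set (ℕ → Bool)) :
    dimH ((fun z => val k (rho z)) '' A) ≤ dimH (val k '' A) / 2 := by
  have hk' : (3 : ℝ) ≤ k := by exact_mod_cast hk
  have hinj := val_injective hk
  let f : ℝ → ℝ := fun s => val k (rho (Function.invFun (val k) s))
  have hf : ∀ z, f (val k z) = val k (rho z) := fun z =>
    congrArg (fun z => val k (rho z)) (Function.leftInverse_invFun hinj z)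
  have hh : HolderOnWith ((k : ℝ≥0) ^ 2) 2 f (val k '' A) := by
    refine holderOnWith_of_dist ?_
    rintro _ ⟨x, -, rfl⟩ _ ⟨y, -, rfl⟩
    rw [hf, hf]
    by_cases hxy : x = y
    · subst hxy
      simp
    obtain ⟨m, hm, hd⟩ := exists_first_diff hxy
    have h1 := le_abs_val_sub hk hm hd
    have h2 := abs_val_sub_le (k := k) (by omega) (rho_agree hm)
    have h3 : (1 / (k : ℝ) ^ (m + 1)) ^ 2 ≤ |val k x - val k y| ^ 2 := by gcongr
    have h4 : (k : ℝ) ^ 2 * (1 / (k : ℝ) ^ (m + 1)) ^ 2 = 1 / (k : ℝ) ^ (2 * m) := by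
      rw [div_pow, one_pow, ← pow_mul, show (m + 1) * 2 = 2 * m + 2 by ring, pow_add]
      field_simp
    push_cast
    rw [Real.rpow_ofNat]
    calc _ ≤ 1 / (k : ℝ) ^ (2 * m) := h2
      _ = (k : ℝ) ^ 2 * (1 / (k : ℝ) ^ (m + 1)) ^ 2 := h4.symm
      _ ≤ _ := by gcongr
  have := hh.dimH_image_le two_pos
  rw [← Set.image_comp] at this
  simpa [Function.comp_def, hf] using this

/-- The value of `w` is the image of the value of a tail under one of countably many
contractions. -/
lemma val_eq_of_shift {k : ℕ} (hk : 2 ≤ k) (w : ℕ → Bool) (m : ℕ) :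
    ∃ P : ℕ, val k w = ((P : ℝ) + val k (shift m w)) / (k : ℝ) ^ m := by
  have hk' : (2 : ℝ) ≤ k := by exact_mod_cast hk
  induction m with
  | zero => exact ⟨0, by simp [shift_zero]⟩
  | succ m ih =>
    obtain ⟨P, hP⟩ := ih
    refine ⟨P * k + if w m then k - 1 else 0, ?_⟩
    rw [hP, val_step hk (shift m w), shift_shift, pow_succ]
    cases hw : w m
    · simp only [shift, hw, add_zero, Bool.false_eq_true, if_false]
      push_cast
      field_simp
      ring
    · simp only [shift, hw, add_zero, if_true]
      push_cast [Nat.cast_sub (by omega : 1 ≤ k)]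
      field_simp
      ring

/-- The values of the sequences admissible for the Thue–Morse bounds have dimension zero: up to
countably many contractions they are the values of the same sequences after substitution, which
halves the dimension. -/
lemma dimH_adm_tm {k : ℕ} (hk : 3 ≤ k) : dimH (val k '' {w | Adm w tm (compl tm)}) = 0 := by
  have hk' : (3 : ℝ) ≤ k := by exact_mod_cast hk
  set A := {w | Adm w tm (compl tm)}
  set R := (fun z => val k (rho z)) '' A
  have hsub : val k '' A ⊆ {val k (fun _ => false), val k (fun _ => true)} ∪
      ⋃ q : ℕ × ℕ, (fun y : ℝ => ((q.1 : ℝ) + y) / (k : ℝ) ^ q.2) '' R := by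
    rintro _ ⟨w, hw, rfl⟩
    rcases adm_tm_cases hw with h | ⟨m, z, hz, hzA⟩
    · left
      cases h0 : w 0
      · exact Or.inl (congrArg _ (funext fun i => (h i).trans h0))
      · exact Or.inr (congrArg (val k) (funext fun i => (h i).trans h0))
    · right
      obtain ⟨P, hP⟩ := val_eq_of_shift (k := k) (by omega) w m
      refine Set.mem_iUnion.mpr ⟨(P, m), val k (rho z), ⟨z, hzA, rfl⟩, ?_⟩
      rw [hP, hz]
  have hlip : ∀ q : ℕ × ℕ,
      dimH ((fun y : ℝ => ((q.1 : ℝ) + y) / (k : ℝ) ^ q.2) '' R) ≤ dimH R := by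
    intro q
    refine LipschitzWith.dimH_image_le (K := 1) (LipschitzWith.of_dist_le_mul fun x y => ?_) R
    rw [Real.dist_eq, Real.dist_eq, ← sub_div, add_sub_add_left_eq_sub, abs_div,
      abs_of_pos (by positivity : (0 : ℝ) < (k : ℝ) ^ q.2), NNReal.coe_one, one_mul]
    exact div_le_self (abs_nonneg _) (one_le_pow₀ (by linarith))
  have h1 : dimH (val k '' A) ≤ dimH R := by
    refine (dimH_mono hsub).trans ?_
    rw [dimH_union, dimH_iUnion, dimH_finite (Set.toFinite _)]
    exact max_le (zero_le) (iSup_le hlip)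
  have h2 := h1.trans (dimH_val_rho_le hk A)
  by_contra h0
  exact absurd h2 (not_le.mpr (ENNReal.half_lt_self h0 (Real.dimH_ne_top _)))

lemma val_tm_lt {k : ℕ} (hk : 2 ≤ k) : val k tm < 1 / k := by
  have hk' : (2 : ℝ) ≤ k := by exact_mod_cast hk
  rw [val_step hk, tm_zero]
  gcongr
  simpa using val_lt_one hk (w := shift 1 tm) (n := 2) tm_three

lemma survivorDim_tm {k : ℕ} (hk : 3 ≤ k) : survivorDim k (val k tm) (1 - val k tm) = 0 := by
  have hk' : (3 : ℝ) ≤ k := by exact_mod_cast hk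
  have hk2 : 2 ≤ k := by omega
  have hc := val_tm_lt hk2
  have hsum : 1 / (k : ℝ) + ((k : ℝ) - 1) / k = 1 := by field_simp; ring
  refine le_antisymm ((dimH_mono ?_).trans (dimH_adm_tm hk).le) (zero_le)
  rintro x ⟨hx, hav⟩
  let w : ℕ → Bool := fun n => decide (((k : ℝ) - 1) / k ≤ (expandingMap k)^[n] x)
  have hlow : ∀ n, w n = false → (expandingMap k)^[n] x ≤ val k tm := by
    intro n hn
    have hn : (expandingMap k)^[n] x < ((k : ℝ) - 1) / k := by simpa [w] using hn
    by_contra hcon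
    exact hav n ⟨not_le.mp hcon, by linarith⟩
  have hhigh : ∀ n, w n = true → 1 - val k tm ≤ (expandingMap k)^[n] x := by
    intro n hn
    have hn : ((k : ℝ) - 1) / k ≤ (expandingMap k)^[n] x := by simpa [w] using hn
    have h2 : 2 / (k : ℝ) ≤ ((k : ℝ) - 1) / k := by gcongr; linarith
    have h3 : 1 / (k : ℝ) ≤ 2 / k := by gcongr; norm_num
    by_contra hcon
    exact hav n ⟨by linarith, not_le.mp hcon⟩
  have hdig : ∀ n, kDigit k x n = if w n then k - 1 else 0 := by
    intro n
    have hm := iterate_expandingMap_mem k hx n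
    rw [kDigit_eq hk2 hx]
    cases hn : w n
    · simp only [Bool.false_eq_true, if_false, Nat.floor_eq_zero]
      have := (hlow n hn).trans_lt hc
      rw [lt_div_iff₀ (by positivity)] at this
      linarith
    · simp only [if_true]
      have h1 : ((k : ℝ) - 1) / k ≤ (expandingMap k)^[n] x := by simpa [w] using hn
      rw [div_le_iff₀ (by positivity)] at h1
      rw [Nat.floor_eq_iff (mul_nonneg (by positivity) hm.1)]
      push_cast [Nat.cast_sub (by omega : 1 ≤ k)]
      constructor <;> nlinarith [hm.2]
  have horb := eq_val_of_digits hk2 hx hdig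
  refine ⟨w, fun m => ⟨fun hm => lexLe_of_val_le hk ?_, fun hm => lexLe_of_val_le hk ?_⟩, ?_⟩
  · rw [← horb]; exact hlow m hm
  · rw [← horb, val_compl hk2]; exact hhigh m hm
  · simpa [shift_zero] using (horb 0).symm

/-! ### A free family of admissible sequences -/

/-- The sequence `01 01 01 ⋯` whose phase is flipped on those windows `[2tq, (2t+1)q)` with
`x t = 1`. For odd `q` every change of phase produces `11`, never `00`. -/
def phaseFlip (q : ℕ) (x : ℕ → Bool) : ℕ → Bool := fun i =>
  xor (decide (i % 2 = 1)) (decide (i / q % 2 = 0) && x (i / q / 2))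

/-- The sequence `011 (01)^∞` up to position `q + 2`, continued by ones. -/
def flipBound (q : ℕ) : ℕ → Bool := fun i => if i < q + 2 then rho zeroOnes i else true

lemma rho_zeroOnes_apply (i : ℕ) :
    rho zeroOnes i = (decide (i = 1) || (decide (2 ≤ i) && decide (i % 2 = 0))) := by
  obtain ⟨t, rfl | rfl⟩ := Nat.even_or_odd' i
  · rw [rho_two_mul]
    rcases Nat.eq_zero_or_pos t with rfl | h
    · simp [zeroOnes]
    · simp [zeroOnes, h.ne', (show 2 ≤ 2 * t by omega)]
  · rw [rho_two_mul_add_one]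
    rcases Nat.eq_zero_or_pos t with rfl | h
    · simp [zeroOnes]
    · simp [zeroOnes, h.ne']

lemma rho_ones_apply (i : ℕ) : rho ones i = decide (i % 2 = 0) := by
  obtain ⟨t, rfl | rfl⟩ := Nat.even_or_odd' i
  · rw [rho_two_mul]; simp [ones]
  · rw [rho_two_mul_add_one]; simp [ones]

lemma phaseFlip_eq_succ {q : ℕ} (hq : q % 2 = 1) {x : ℕ → Bool} {i : ℕ}
    (h : phaseFlip q x (i + 1) = phaseFlip q x i) : phaseFlip q x i = true ∧ (i + 1) % q = 0 := by
  have hq0 : 0 < q := by omega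
  by_cases hd : (i + 1) % q = 0
  · refine ⟨?_, hd⟩
    obtain ⟨t, ht⟩ := Nat.dvd_of_mod_eq_zero hd
    obtain ⟨t, rfl⟩ : ∃ s, t = s + 1 := ⟨t - 1, by cases t <;> simp at ht ⊢⟩
    have e1 : (i + 1) / q = t + 1 := by rw [ht, Nat.mul_div_cancel_left _ hq0]
    have e0 : i / q = t := by
      rw [Nat.div_eq_iff hq0]
      rw [mul_add, mul_comm] at ht
      omega
    have hpar : (i + 1) % 2 = (t + 1) % 2 := by rw [ht, Nat.mul_mod, hq]; simp
    simp only [phaseFlip, e0, e1] at h ⊢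
    rcases Nat.mod_two_eq_zero_or_one t with h0 | h0
    · have p1 : (i + 1) % 2 = 1 := by omega
      have p2 : (t + 1) % 2 = 1 := by omega
      rw [← h]
      simp [p1, p2]
    · have p1 : i % 2 = 1 := by omega
      simp [p1, h0]
  · have e : (i + 1) / q = i / q := Nat.succ_div_of_not_dvd fun hc => hd (Nat.mod_eq_zero_of_dvd hc)
    simp only [phaseFlip, e] at h
    generalize (decide (i / q % 2 = 0) && x (i / q / 2)) = c at h
    rcases Nat.mod_two_eq_zero_or_one i with h0 | h0
    · have p1 : (i + 1) % 2 = 1 := by omega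
      cases c <;> simp [h0, p1] at h
    · have p1 : (i + 1) % 2 = 0 := by omega
      cases c <;> simp [h0, p1] at h

lemma adm_phaseFlip {q : ℕ} (hq : q % 2 = 1) (x : ℕ → Bool) :
    Adm (phaseFlip q x) (flipBound q) (rho ones) := by
  intro m
  constructor
  · intro hm n hn hw
    by_cases hnq : n < q + 2
    swap
    · simp [flipBound, hnq]
    simp only [flipBound, hnq, if_true, rho_zeroOnes_apply]
    by_contra hc
    have hodd : n % 2 = 1 ∧ 3 ≤ n ∨ n = 0 := by
      simp at hc; omega
    rcases hodd with ⟨hodd, hn3⟩ | rfl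
    swap
    · rw [shift, add_zero, hm] at hw
      exact absurd hw (by simp)
    have h1 := hn 1 (by omega)
    have h2 := hn 2 (by omega)
    have h3 := hn (n - 1) (by omega)
    have a1 : (1 : ℕ) < q + 2 := by omega
    have a2 : (2 : ℕ) < q + 2 := by omega
    have a3 : n - 1 < q + 2 := by omega
    have a4 : (n - 1) % 2 = 0 := by omega
    have a5 : 2 ≤ n - 1 := by omega
    simp only [flipBound, a1, a2, a3, if_true, rho_zeroOnes_apply, a4, a5, shift] at h1 h2 h3 hw
    simp at h1 h2 h3
    have b1 := (phaseFlip_eq_succ hq (x := x) (i := m + 1) (by rw [h1]; exact h2)).2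
    have b2 := (phaseFlip_eq_succ hq (x := x) (i := m + (n - 1))
      (by rw [h3, show m + (n - 1) + 1 = m + n by omega, hw])).2
    -- Two changes of phase would lie fewer than `q` steps apart.
    have d1 := Nat.dvd_of_mod_eq_zero b1
    have d2 := Nat.dvd_of_mod_eq_zero b2
    have d3 : q ∣ n - 2 := by
      have := Nat.dvd_sub d2 d1
      rwa [show m + (n - 1) + 1 - (m + 1 + 1) = n - 2 by omega] at this
    have := Nat.le_of_dvd (by omega) d3
    omega
  · intro hm n hn hw
    rw [rho_ones_apply] at hw
    have hw : n % 2 = 0 := by simpa using hw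
    cases n with
    | zero => exact hm
    | succ n =>
      have h1 := hn n (by omega)
      rw [rho_ones_apply, decide_eq_false (by omega)] at h1
      by_contra hc
      have h0 : phaseFlip q x (m + n) = false := h1.symm
      have h2 : phaseFlip q x (m + n + 1) = false := by simpa [shift, add_assoc] using hc
      have := (phaseFlip_eq_succ hq (h2.trans h0.symm)).1
      simp [h0] at this

lemma phaseFlip_mul {q : ℕ} (hq : 0 < q) (x : ℕ → Bool) (t : ℕ) :
    phaseFlip q x (2 * q * t) = x t := by
  have e : 2 * q * t / q = 2 * t := by
    rw [show 2 * q * t = q * (2 * t) by ring, Nat.mul_div_cancel_left _ hq]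
  have e2 : 2 * q * t % 2 = 0 := by rw [mul_assoc]; simp
  simp [phaseFlip, e, e2]

/-! ### Holes shorter than the symmetric one -/

/-- Beyond the image under `rho^[n + 1]` of the trivial bound `01^∞` there is room for a free
family. -/
lemma exists_free_family {k : ℕ} (hk : 3 ≤ k) {a b : ℝ} {n : ℕ}
    (ha : val k (rho^[n] (rho zeroOnes)) < a) (hb : b ≤ val k (rho^[n] (rho ones))) :
    ∃ (L : ℕ) (F : (ℕ → Bool) → ℕ → Bool), (∀ x i, F x (L * i) = x i) ∧
      ∀ x m, val k (shift m (F x)) ≤ a ∨ b ≤ val k (shift m (F x)) := by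
  have hk' : (3 : ℝ) ≤ k := by exact_mod_cast hk
  have hk2 : 2 ≤ k := by omega
  obtain ⟨N, hN⟩ := exists_pow_lt_of_lt_one (sub_pos.mpr ha)
    (by rw [div_lt_one (by linarith)]; linarith : 1 / (k : ℝ) < 1)
  obtain ⟨q, hq, hqN⟩ : ∃ q, q % 2 = 1 ∧ N ≤ q := ⟨2 * N + 1, by omega, by omega⟩
  have hbound : val k (rho^[n] (flipBound q)) ≤ a := by
    have hag : ∀ i < q + 2, flipBound q i = rho zeroOnes i := fun i hi => by simp [flipBound, hi]
    have h1 := val_sub_le hk2 (iterate_rho_agree hag n)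
    have h2 : 1 / (k : ℝ) ^ ((q + 2) * 2 ^ n) ≤ (1 / (k : ℝ)) ^ N := by
      rw [div_pow, one_pow]
      gcongr
      · linarith
      · nlinarith [Nat.one_le_two_pow (n := n)]
    linarith
  refine ⟨2 ^ n * (2 * q), fun x => rho^[n] (phaseFlip q x), fun x i => ?_, fun x m => ?_⟩
  · simp only [mul_assoc (2 ^ n), iterate_rho_mul, phaseFlip_mul (show 0 < q by omega)]
  · have hadm := adm_iterate_rho (adm_phaseFlip hq x) (by simp [flipBound, rho_zeroOnes_apply])
      (by simp [flipBound, rho_zeroOnes_apply]) (by simp [rho_ones_apply])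
      (by simp [rho_ones_apply]) n m
    cases hm : rho^[n] (phaseFlip q x) m
    · exact Or.inl ((val_mono hk2 (hadm.1 hm)).trans hbound)
    · exact Or.inr (hb.trans (val_mono hk2 (hadm.2 hm)))

/-- The gap between the bounds `(10)^∞` and `01^∞` at any level of substitution is at least the gap
between the Thue–Morse sequence and its complement. -/
lemma gap_le {k : ℕ} (hk : 3 ≤ k) (n : ℕ) :
    1 - 2 * val k tm ≤ val k (rho^[n] (rho ones)) - val k (rho^[n] zeroOnes) := by
  have hk' : (3 : ℝ) ≤ k := by exact_mod_cast hk
  have hk2 : 2 ≤ k := by omega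
  have hpos : 0 < 2 ^ n := by positivity
  -- `(10)^∞` and `1001 ⋯` differ first in the third symbol, `01^∞` and `0110 ⋯` in the fourth.
  have h1 : 1 / (k : ℝ) ^ (2 * 2 ^ n + 1)
      ≤ val k (rho^[n] (rho ones)) - val k (rho^[n] (compl tm)) := by
    refine le_val_sub hk (iterate_rho_agree (m := 2) ?_ n) ?_ ?_
    · intro i hi
      interval_cases i <;> simp [rho_ones_apply, compl, tm_zero, tm_one]
    · rw [mul_comm, iterate_rho_mul]; simp [rho_ones_apply]
    · rw [mul_comm, iterate_rho_mul]; simp [compl, tm_two]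
  have h2 : val k (rho^[n] zeroOnes) - val k (rho^[n] tm) ≤ 1 / (k : ℝ) ^ (3 * 2 ^ n) := by
    refine val_sub_le hk2 (iterate_rho_agree (m := 3) ?_ n)
    intro i hi
    interval_cases i <;> simp [zeroOnes, tm_zero, tm_one, tm_two]
  have h3 : 1 / (k : ℝ) ^ (3 * 2 ^ n) ≤ 1 / (k : ℝ) ^ (2 * 2 ^ n + 1) := by
    gcongr
    · linarith
    · omega
  rw [iterate_rho_compl, iterate_rho_tm, val_compl hk2] at h1
  rw [iterate_rho_tm] at h2
  linarith

/-- If a hole in `R_2` is shorter than the symmetric one and its survivor set has dimension zero,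
then its ends are enclosed by the images of the trivial bounds under `rho^[n]`, for every `n`.
Level `0` is the region `R_2`. In the step from `n` to `n + 1` the outer bounds follow from the
length of the hole, the inner ones from the dimension. -/
lemma bounds_of_survivorDim_eq_zero {k : ℕ} (hk : 3 ≤ k) {a b : ℝ} (hab : (a, b) ∈ holesR2 k)
    (hlt : b - a < 1 - 2 * val k tm) (h0 : survivorDim k a b = 0) (n : ℕ) :
    (1 - val k (rho^[n] ones) ≤ a ∧ a ≤ val k (rho^[n] zeroOnes)) ∧
      (1 - val k (rho^[n] zeroOnes) ≤ b ∧ b ≤ val k (rho^[n] ones)) := by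
  have hk' : (3 : ℝ) ≤ k := by exact_mod_cast hk
  have hk2 : 2 ≤ k := by omega
  obtain ⟨⟨ha0, ha1⟩, hb0, hb1⟩ := hab
  simp only at ha0 ha1 hb0 hb1
  induction n with
  | zero =>
    have e1 : val k ones = 1 := by simpa [val, ones] using (hasSum_ones hk2).tsum_eq
    have e2 : val k zeroOnes = 1 / k := by
      rw [val_step hk2, show shift 1 zeroOnes = ones by funext i; simp [shift, zeroOnes, ones], e1]
      simp [zeroOnes]
    have e3 : 1 - 1 / (k : ℝ) = ((k : ℝ) - 1) / k := by field_simp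
    simp only [Function.iterate_zero, id_eq, e1, e2, e3]
    exact ⟨⟨by linarith, ha1⟩, hb0, hb1⟩
  | succ n ih =>
    obtain ⟨⟨ha2, ha3⟩, hb2, hb3⟩ := ih
    have hg := gap_le hk n
    simp only [Function.iterate_succ_apply]
    have hbu : b ≤ val k (rho^[n] (rho ones)) := by linarith
    have hal : 1 - val k (rho^[n] (rho ones)) ≤ a := by linarith
    refine ⟨⟨hal, ?_⟩, ?_, hbu⟩
    · by_contra hc
      obtain ⟨L, F, hF, hav⟩ := exists_free_family hk (not_le.mp hc) hbu
      refine (survivorDim_pos hk ha0 (L := L) (F := F) (b := b) (fun x y i h => ?_)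
        fun x m hm => ?_).ne' h0
      · rwa [hF, hF] at h
      · rcases hav x m with h | h
        · exact absurd hm.1 (not_lt.mpr h)
        · exact absurd hm.2 (not_lt.mpr h)
    · by_contra hc
      obtain ⟨L, F, hF, hav⟩ := exists_free_family hk (a := 1 - b) (b := 1 - a) (n := n)
        (by linarith) (by linarith)
      refine (survivorDim_pos hk ha0 (L := L) (F := fun x => compl (F x)) (b := b)
        (fun x y i h => ?_) fun x m hm => ?_).ne' h0
      · simpa [compl, hF] using h
      · rw [shift_compl, val_compl hk2] at hm
        rcases hav x m with h | h
        · linarith [hm.2]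
        · linarith [hm.1]

lemma survivorDim_pos_of_lt {k : ℕ} (hk : 3 ≤ k) {a b : ℝ} (hab : (a, b) ∈ holesR2 k)
    (hlt : b - a < 1 - 2 * val k tm) : 0 < survivorDim k a b := by
  have hk' : (3 : ℝ) ≤ k := by exact_mod_cast hk
  have hk2 : 2 ≤ k := by omega
  rw [pos_iff_ne_zero]
  intro h0
  obtain ⟨n, hn⟩ := exists_pow_lt_of_lt_one
    (half_pos (sub_pos.mpr hlt)) (by rw [div_lt_one (by linarith)]; linarith : 1 / (k : ℝ) < 1)
  obtain ⟨⟨-, ha⟩, hb, -⟩ := bounds_of_survivorDim_eq_zero hk hab hlt h0 n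
  have h1 := val_sub_le hk2 (iterate_rho_agree (w := zeroOnes) (z := tm) (m := 1)
    (by intro i hi; interval_cases i; simp [zeroOnes, tm_zero]) n)
  have h2 : 1 / (k : ℝ) ^ (1 * 2 ^ n) ≤ (1 / (k : ℝ)) ^ n := by
    rw [div_pow, one_pow]
    gcongr
    · linarith
    · rw [one_mul]; exact Nat.lt_two_pow_self.le
  rw [iterate_rho_tm] at h1
  linarith

end ThueMorseHole

theorem corollary4p10 (k : ℕ) (hk : 3 ≤ k) :
    ∃ c : ℝ, {x | x ∈ Set.Icc (0 : ℝ) 1 ∧ cantorFun k x = thueMorseConst} = {c} ∧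
      (∀ a b : ℝ, (a, b) ∈ holesR2 k → b - a < 1 - 2 * c → 0 < survivorDim k a b) ∧
      (∃ a b : ℝ, (a, b) ∈ holesR2 k ∧ b - a = 1 - 2 * c ∧ survivorDim k a b = 0) := by
  have hk' : (3 : ℝ) ≤ k := by exact_mod_cast hk
  have hk2 : 2 ≤ k := by omega
  have h0 := ThueMorseHole.val_nonneg hk2 ThueMorseHole.tm
  have h1 := ThueMorseHole.val_tm_lt hk2
  refine ⟨ThueMorseHole.val k ThueMorseHole.tm, ?_,
    fun a b hab hlt => ThueMorseHole.survivorDim_pos_of_lt hk hab hlt,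
    ThueMorseHole.val k ThueMorseHole.tm, 1 - ThueMorseHole.val k ThueMorseHole.tm,
    ⟨⟨h0, h1.le⟩, ?_, ?_⟩, by ring, ThueMorseHole.survivorDim_tm hk⟩
  · ext x
    simp only [Set.mem_ofPred_eq, Set.mem_singleton_iff]
    constructor
    · rintro ⟨hx, h⟩
      exact ThueMorseHole.eq_val_tm_of_cantorFun hk2 hx h
    · rintro rfl
      exact ⟨⟨h0, ThueMorseHole.val_le_one hk2 _⟩, ThueMorseHole.cantorFun_val_tm hk2⟩
  · have : ((k : ℝ) - 1) / k = 1 - 1 / k := by field_simp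
    simp only [this]
    linarith
  · simp only
    linarith
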